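/- Let $\mathbb K$ be a field of characteristic zero. A packed word is a finite word $w$ on the positive integers such that the set of its letters is $\{1,\dots,m\}$ for some $m\ge 0$ (the empty word $\epsilon$ is packed); write $\max w=m$. Let $V$ be the vector space with basis $(F_u)$ indexed by all packed words $u$. *Operadic composition.* For a packed word $u$ of length $n$, $1\le i\le n$, and a nonempty packed word $v$ with $\max v=s$, let $u\circ_i v$ be the packed word obtained from $u$ by replacing the $i$-th letter $b=u(i)$ by the word $v$ with all letters increased by $b-1$, while each letter $a$ of $u$ at a position $<i$ with $a>b$, and each letter $a$ of $u$ at a position $>i$ with $a\ge b$, is increased by $s-1$. Set $F_u\circ_i F_v=F_{u\circ_i v}$, extended bilinearly (the right associative operad of packed words $\mathsf{PAs}^{\to}$, in the basis $F$). *Left weak order.* For a packed word $u$, let $\mathrm{Inv}_\ell(u)$ be the set of pairs $i<j$ of letters of $u$ such that all occurrences of $i$ in $u$ come after all occurrences of $j$. The left weak order $\le_\ell$ is the reflexive transitive closure of the relation in which $v$ covers $u$ if $v$ is obtained from $u$ by exchanging two consecutive values $i$ and $i+1$ of its alphabet and $|\mathrm{Inv}_\ell(v)|=|\mathrm{Inv}_\ell(u)|+1$.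 The basis $(M_u)$ of $V$ is defined by $F_u=\sum_{u\le_\ell v}M_v$. Put $\{x,y\}=(M_{12}\circ_2 y)\circ_1 x$; in particular $\{F_u,F_v\}=(M_{12}\circ_2F_v)\circ_1F_u$ for nonempty packed words $u,v$. *Hopf algebra.* View $V$ as the Hopf algebra $\mathsf{WQSym}$ of packed words with unit $F_\epsilon$, product of the $F_u$ the shifted shuffle, and coproduct $\Delta(F_u)=\sum_p F_{\mathrm{pack}(u(1)\cdots u(p))}\otimes F_{\mathrm{pack}(u(p+1)\cdots u(n))}$, the sum being over those $0\le p\le n$ for which $u(1)\cdots u(p)$ and $u(p+1)\cdots u(n)$ have no common letter, where $\mathrm{pack}$ replaces each letter by its rank among the letters of the word. A Zie element is a primitive element: $\Delta(x)=x\otimes F_\epsilon+F_\epsilon\otimes x$. **Theorem.** Let $k\ge 1$ and let $\mathsf c=(c_1,\dots,c_n)$ be a composition of $k$ (into positive parts). Let $\mathrm{id}_r=1\cdots1$ ($r$ letters), let $\mathrm{id}(\mathsf c)$ be the non-decreasing word with $c_r$ copies of $r$ for each $r\in\{1,\dots,n\}$, and let $$\theta_k^{\mathsf c}=\{\dots\{\{F_{\mathrm{id}_{c_1}},F_{\mathrm{id}_{c_2}}\},F_{\mathrm{id}_{c_3}}\},\dots,F_{\mathrm{id}_{c_n}}\}$$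 (which is $F_{\mathrm{id}_k}$ if $n=1$). Then $$\theta_k^{\mathsf c}=\sum_u M_u,$$ where $u$ runs over the packed words with $\mathrm{id}(\mathsf c)\le_\ell u$ of the form $u=(\mathrm{id}_{c_1}2)\circ_{c_1+1}u'$ for some packed word $u'$, that is, $u$ is $\mathrm{id}_{c_1}$ followed by $u'$ with all its letters increased by $1$ (for $n=1$, $u'=\epsilon$ and $u=\mathrm{id}_{c_1}$). In particular, $\theta_k^{\mathsf c}$ is a Zie element of $\mathsf{WQSym}$. -/

import Mathlib

open scoped TensorProduct

namespace PAsRight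

/-! ### Packed words -/

/-- A word on the positive integers is packed if, for every `i ≥ 2`, the letter `i - 1` appears
whenever `i` does. The empty word is packed. -/
def IsPacked (w : List ℕ) : Prop :=
  (∀ a ∈ w, 1 ≤ a) ∧ ∀ a, 1 ≤ a → a + 1 ∈ w → a ∈ w

/-- The set of all packed words, of all lengths. -/
abbrev PackedWord : Type := {w : List ℕ // IsPacked w}

/-- The greatest letter of a word (`0` for the empty word); a packed word `w` has
alphabet `{1, …, maxLetter w}`. -/
def maxLetter (w : List ℕ) : ℕ := w.foldr max 0

theorem le_maxLetter {w : List ℕ} {a : ℕ} (h : a ∈ w) : a ≤ maxLetter w := by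
  induction w with
  | nil => simp at h
  | cons b w ih =>
    simp only [maxLetter, List.foldr_cons] at ih ⊢
    rcases List.mem_cons.1 h with h | h
    · subst h; exact le_max_left _ _
    · exact (ih h).trans (le_max_right _ _)

theorem maxLetter_mem {w : List ℕ} (h : w ≠ []) : maxLetter w ∈ w := by
  induction w with
  | nil => exact absurd rfl h
  | cons b w ih =>
    by_cases hw : w = []
    · subst hw; simp [maxLetter]
    · have := ih hw
      simp only [maxLetter, List.foldr_cons] at this ⊢
      rcases max_choice b (w.foldr max 0) with h | h
      · rw [h]; simp
      · rw [h]; exact List.mem_cons_of_mem _ this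

theorem IsPacked.mem_of_le {w : List ℕ} (hw : IsPacked w) {a b : ℕ} (hb : b ∈ w)
    (h1 : 1 ≤ a) (hab : a ≤ b) : a ∈ w := by
  obtain ⟨d, rfl⟩ := Nat.exists_eq_add_of_le hab
  clear hab
  induction d with
  | zero => exact hb
  | succ d ih => exact ih (hw.2 _ (by omega) hb)

/-! ### The partial compositions -/

/-- `incr α β w`: the letters of `w` that are greater than `β` are incremented by `α`. -/
def incr (α β : ℕ) (w : List ℕ) : List ℕ := w.map fun a => if β < a then a + α else a

/-- The insertion of `v` into `u` at position `i` (positions are counted from `1`):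
with `b` the `i`-th letter of `u` and `s` the greatest letter of `v`, it is the word
`incr (s-1) b (u(1,i-1)) . incr (b-1) 0 v . incr (s-1) (b-1) (u(i+1,n))`. -/
def insertWord (u : List ℕ) (i : ℕ) (v : List ℕ) : List ℕ :=
  incr (maxLetter v - 1) (u.getD (i - 1) 0) (u.take (i - 1)) ++
    incr (u.getD (i - 1) 0 - 1) 0 v ++
    incr (maxLetter v - 1) (u.getD (i - 1) 0 - 1) (u.drop i)

theorem isPacked_insertWord {u v : List ℕ} (hu : IsPacked u) (hv : IsPacked v) (hv0 : v ≠ [])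
    {i : ℕ} (h1 : 1 ≤ i) (hi : i ≤ u.length) : IsPacked (insertWord u i v) := by
  obtain ⟨j, rfl⟩ : ∃ j, i = j + 1 := ⟨i - 1, by omega⟩
  have hj : j < u.length := by omega
  have hb : u.getD j 0 = u[j] := by simp [hj]
  have hsplit : u = u.take j ++ u[j] :: u.drop (j + 1) := by simp
  have hbu : u[j] ∈ u := List.getElem_mem hj
  have hb1 : 1 ≤ u[j] := hu.1 _ hbu
  have hs := maxLetter_mem hv0
  have hs1 : 1 ≤ maxLetter v := hv.1 _ hs
  have hsle : ∀ a ∈ v, a ≤ maxLetter v := fun a ha => le_maxLetter ha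
  have hmemu : ∀ x, x ∈ u ↔ x ∈ u.take j ∨ x = u[j] ∨ x ∈ u.drop (j + 1) := by
    intro x
    have h : x ∈ u ↔ x ∈ u.take j ++ u[j] :: u.drop (j + 1) := by rw [← hsplit]
    rw [h, List.mem_append, List.mem_cons]
  have hmem : ∀ t, t ∈ insertWord u (j + 1) v ↔
      (∃ x ∈ u.take j, (if u[j] < x then x + (maxLetter v - 1) else x) = t) ∨
      (∃ y ∈ v, (if 0 < y then y + (u[j] - 1) else y) = t) ∨
      (∃ x ∈ u.drop (j + 1), (if u[j] - 1 < x then x + (maxLetter v - 1) else x) = t) := by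
    intro t
    simp only [insertWord, incr, Nat.add_sub_cancel, hb, List.mem_append, List.mem_map, or_assoc]
  generalize maxLetter v = s at *
  generalize hbb : u[j] = b at *
  have hA : ∀ x ∈ u, x < b → x ∈ insertWord u (j + 1) v := by
    intro x hx hxb
    rw [hmem]
    rcases (hmemu x).1 hx with h | h | h
    · exact Or.inl ⟨x, h, by split_ifs <;> omega⟩
    · omega
    · exact Or.inr (Or.inr ⟨x, h, by split_ifs <;> omega⟩)
  have hB : ∀ x ∈ u, b < x → x + (s - 1) ∈ insertWord u (j + 1) v := by
    intro x hx hxb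
    rw [hmem]
    rcases (hmemu x).1 hx with h | h | h
    · exact Or.inl ⟨x, h, by split_ifs; rfl⟩
    · omega
    · exact Or.inr (Or.inr ⟨x, h, by split_ifs <;> omega⟩)
  have hC : ∀ t, b ≤ t → t ≤ b + (s - 1) → t ∈ insertWord u (j + 1) v := by
    intro t ht1 ht2
    rw [hmem]
    exact Or.inr (Or.inl ⟨t - (b - 1), hv.mem_of_le hs (by omega) (by omega),
      by split_ifs <;> omega⟩)
  refine ⟨fun a ha => ?_, fun a ha1 ha => ?_⟩
  · rw [hmem] at ha
    rcases ha with ⟨x, hx, h⟩ | ⟨x, hx, h⟩ | ⟨x, hx, h⟩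
    · have := hu.1 x ((hmemu x).2 (Or.inl hx))
      split_ifs at h <;> omega
    · have := hv.1 x hx
      split_ifs at h <;> omega
    · have := hu.1 x ((hmemu x).2 (Or.inr (Or.inr hx)))
      split_ifs at h <;> omega
  · by_cases c1 : a + 1 ≤ b
    · exact hA a (hu.mem_of_le hbu ha1 (by omega)) (by omega)
    by_cases c2 : a ≤ b + (s - 1)
    · exact hC a (by omega) c2
    have key : ∀ x ∈ u, x + (s - 1) = a + 1 → a ∈ insertWord u (j + 1) v := by
      intro x hx h
      have h2 := hB (x - 1) (hu.mem_of_le hx (by omega) (by omega)) (by omega)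
      have h3 : x - 1 + (s - 1) = a := by omega
      rwa [h3] at h2
    rw [hmem] at ha
    rcases ha with ⟨x, hx, h⟩ | ⟨x, hx, h⟩ | ⟨x, hx, h⟩
    · refine key x ((hmemu x).2 (Or.inl hx)) ?_
      split_ifs at h <;> omega
    · have := hsle x hx
      split_ifs at h <;> omega
    · refine key x ((hmemu x).2 (Or.inr (Or.inr hx))) ?_
      split_ifs at h <;> omega

/-! ### The left weak order -/

/-- The left-inversions of `w`: the pairs `(i, j)` of letters of `w` such that `i < j` and all
appearances of `i` in `w` occur after all appearances of `j`. -/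
def leftInv (w : List ℕ) : Finset (ℕ × ℕ) :=
  (w.toFinset ×ˢ w.toFinset).filter fun x =>
    x.1 < x.2 ∧ ∀ p q : Fin w.length, w[p] = x.1 → w[q] = x.2 → q < p

/-- The covering relation of the left weak order: `v` arises from `u` by exchanging the values
`i` and `i + 1`, both in the alphabet of `u`, and has one left-inversion more. -/
def LeftCover (u v : PackedWord) : Prop :=
  ∃ i, i ∈ u.1 ∧ i + 1 ∈ u.1 ∧ v.1 = u.1.map (Equiv.swap i (i + 1)) ∧
    (leftInv v.1).card = (leftInv u.1).card + 1

/-- The left weak order `u ≤_ℓ v` on packed words. -/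
def LeftLE (u v : PackedWord) : Prop := Relation.ReflTransGen LeftCover u v

theorem LeftLE.card_le {u v : PackedWord} (h : LeftLE u v) :
    (leftInv u.1).card ≤ (leftInv v.1).card := by
  induction h with
  | refl => exact le_rfl
  | tail _ h ih => obtain ⟨i, -, -, -, h⟩ := h; omega

theorem LeftLE.antisymm {u v : PackedWord} (h : LeftLE u v) (h' : LeftLE v u) : u = v := by
  rcases Relation.ReflTransGen.cases_head h with h0 | ⟨w, ⟨i, -, -, -, hw⟩, hwv⟩
  · exact h0
  · have h1 := LeftLE.card_le hwv
    have h2 := LeftLE.card_le h'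
    omega

theorem finite_upper (u : PackedWord) : {v : PackedWord | LeftLE u v}.Finite := by
  have key : ∀ v, LeftLE u v → v.1.length = u.1.length ∧ ∀ a ∈ v.1, a < maxLetter u.1 + 1 := by
    intro v h
    induction h with
    | refl => exact ⟨rfl, fun a ha => Nat.lt_succ_of_le (le_maxLetter ha)⟩
    | tail _ h ih =>
      obtain ⟨i, hi, hi', hw, -⟩ := h
      refine ⟨by rw [hw, List.length_map, ih.1], fun a ha => ?_⟩
      rw [hw, List.mem_map] at ha
      obtain ⟨b, hb, rfl⟩ := ha
      rw [Equiv.swap_apply_def]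
      split_ifs
      · exact ih.2 _ hi'
      · exact ih.2 _ hi
      · exact ih.2 _ hb
  have hfin := (List.finite_length_eq (Fin (maxLetter u.1 + 1)) u.1.length).image
    (List.map Fin.val)
  refine (hfin.preimage (f := fun v : PackedWord => v.1)
    Subtype.val_injective.injOn).subset fun v hv => ?_
  obtain ⟨h1, h2⟩ := key v hv
  refine ⟨v.1.pmap (fun a h => (⟨a, h⟩ : Fin (maxLetter u.1 + 1))) h2, by simpa using h1, ?_⟩
  simp [List.map_pmap]

/-- The finite set of the packed words `v` with `u ≤_ℓ v`. -/
noncomputable def upper (u : PackedWord) : Finset PackedWord := (finite_upper u).toFinset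

theorem mem_upper {u v : PackedWord} : v ∈ upper u ↔ LeftLE u v := by
  simp [upper]

theorem card_upper_lt {u v : PackedWord} (h : LeftLE u v) (hne : v ≠ u) :
    (upper v).card < (upper u).card := by
  refine Finset.card_lt_card ⟨fun w hw => ?_, fun hsub => ?_⟩
  · exact mem_upper.2 (Relation.ReflTransGen.trans h (mem_upper.1 hw))
  · exact hne (LeftLE.antisymm (mem_upper.1 (hsub (mem_upper.2 Relation.ReflTransGen.refl))) h)

/-! ### The space of packed words and its `F` and `M` bases -/

/-- The vector space on all packed words, with basis `F_u`. The words of length `n ≥ 1`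
span the arity `n` component of the operad; the empty word spans degree `0` of the Hopf algebra. -/
abbrev WQSym (K : Type*) [Field K] : Type _ := PackedWord →₀ K

section

variable (K : Type*) [Field K]

/-- The basis element `F_u`. -/
noncomputable def F (u : PackedWord) : WQSym K := Finsupp.single u 1

open Classical in
/-- The basis `M`, defined by `F_u = ∑_{u ≤_ℓ v} M_v`, that is, recursively by
`M_u = F_u - ∑_{u <_ℓ v} M_v`. -/
noncomputable def M (u : PackedWord) : WQSym K :=
  F K u - ∑ v ∈ ((upper u).erase u).attach, M v.1
termination_by (upper u).card
decreasing_by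
  exact card_upper_lt (mem_upper.1 (Finset.mem_of_mem_erase v.2)) (Finset.ne_of_mem_erase v.2)

open Classical in
/-- The defining relation of the basis `M`. -/
theorem F_eq_sum_M (u : PackedWord) : F K u = ∑ v ∈ upper u, M K v := by
  have hu : u ∈ upper u := mem_upper.2 Relation.ReflTransGen.refl
  rw [← Finset.add_sum_erase _ _ hu, M, Finset.sum_attach _ (fun v => M K v), sub_add_cancel]

open Classical in
/-- The partial composition `∘_i`: the bilinear map with `F_u ∘_i F_v = F_{u ∘_i v}` for `v` of
length at least `1` and `i` a position of `u`. It is `0` where the composition is not defined. -/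
noncomputable def circ (i : ℕ) : WQSym K →ₗ[K] WQSym K →ₗ[K] WQSym K :=
  Finsupp.linearCombination K fun u => Finsupp.linearCombination K fun v =>
    if h : v.1 ≠ [] ∧ 1 ≤ i ∧ i ≤ u.1.length then
      F K ⟨insertWord u.1 i v.1, isPacked_insertWord u.2 v.2 h.1 h.2.1 h.2.2⟩
    else 0

/-- The packed word `12`. -/
def word12 : PackedWord := ⟨[1, 2], by
  refine ⟨by simp, fun a ha h => ?_⟩
  simp only [List.mem_cons, List.not_mem_nil, or_false] at h ⊢
  omega⟩

/-- The operation `{x, y} = (M_{12} ∘_2 y) ∘_1 x`. -/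
noncomputable def bracket (x y : WQSym K) : WQSym K :=
  circ K 1 (circ K 2 (M K word12) y) x

/-! ### The element `θ` of a composition -/

/-- The packed word `id_r = 1 1 ⋯ 1` of length `r`. -/
def idWord (r : ℕ) : PackedWord := ⟨List.replicate r 1, by
  refine ⟨fun a ha => (List.eq_of_mem_replicate ha).ge, fun a ha h => ?_⟩
  have := List.eq_of_mem_replicate h
  omega⟩

/-- The left-nested bracket `{…{{F_{id_{c₁}}, F_{id_{c₂}}}, F_{id_{c₃}}}, …, F_{id_{cₙ}}}` of a
list `c₁, …, cₙ` (with a default value for the empty list). -/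
noncomputable def nestedBracket : List ℕ → WQSym K
  | [] => 0
  | r :: l => l.foldl (fun x s => bracket K x (F K (idWord s))) (F K (idWord r))

/-- The element `θ_k^c` of a composition `c` of `k`. -/
noncomputable def theta {k : ℕ} (c : Composition k) : WQSym K := nestedBracket K c.blocks

end

/-- The word with `c₁` copies of `m + 1`, then `c₂` copies of `m + 2`, and so on. -/
def idListFrom (m : ℕ) : List ℕ → List ℕ
  | [] => []
  | r :: l => List.replicate r (m + 1) ++ idListFrom (m + 1) l

theorem mem_idListFrom {l : List ℕ} (hl : ∀ r ∈ l, 1 ≤ r) {m a : ℕ} :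
    a ∈ idListFrom m l ↔ m + 1 ≤ a ∧ a ≤ m + l.length := by
  induction l generalizing m with
  | nil => simp [idListFrom]
  | cons r l ih =>
    have hr := hl r (by simp)
    rw [idListFrom, List.mem_append, ih fun s hs => hl s (by simp [hs])]
    simp only [List.mem_replicate, List.length_cons]
    omega

/-- `id(c)`: the non-decreasing packed word with `c_r` copies of `r` for each `r`. -/
def idComp {k : ℕ} (c : Composition k) : PackedWord := ⟨idListFrom 0 c.blocks, by
  have h : ∀ r ∈ c.blocks, 1 ≤ r := fun r hr => c.one_le_blocks hr
  refine ⟨fun a ha => ?_, fun a ha1 ha => ?_⟩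
  · rw [mem_idListFrom h] at ha; omega
  · rw [mem_idListFrom h] at ha ⊢; omega⟩

/-- `u` has the form `(id_r 2) ∘ u'` for a packed word `u'`, where `u'` is inserted at the
last position `r + 1` of the word `id_r 2 = 1 ⋯ 1 2`. For `u'` empty this gives `u = id_r`. -/
def StartsWithBlock (r : ℕ) (u : PackedWord) : Prop :=
  ∃ u' : PackedWord, u.1 = insertWord (List.replicate r 1 ++ [2]) (r + 1) u'.1

/-! ### The coproduct and the primitive elements -/

/-- The packing of a word: each letter is replaced by its rank among the letters of the word. -/
def packList (w : List ℕ) : List ℕ := w.map fun a => (w.toFinset.filter (· ≤ a)).card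

theorem isPacked_packList (w : List ℕ) : IsPacked (packList w) := by
  refine ⟨fun t ht => ?_, fun t ht1 ht => ?_⟩
  · obtain ⟨a, ha, rfl⟩ := List.mem_map.1 ht
    exact Finset.card_pos.2 ⟨a, by simp [ha]⟩
  · obtain ⟨a, ha, hat⟩ := List.mem_map.1 ht
    have h1 : w.toFinset.filter (· ≤ a) = insert a (w.toFinset.filter (· < a)) := by
      ext x
      simp only [Finset.mem_filter, List.mem_toFinset, Finset.mem_insert]
      constructor
      · rintro ⟨hx, hxa⟩
        rcases hxa.eq_or_lt with h | h
        · exact Or.inl h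
        · exact Or.inr ⟨hx, h⟩
      · rintro (rfl | ⟨hx, hxa⟩)
        · exact ⟨ha, le_rfl⟩
        · exact ⟨hx, hxa.le⟩
    have hcard : (w.toFinset.filter (· < a)).card = t := by
      rw [h1, Finset.card_insert_of_notMem (by simp)] at hat
      omega
    have hne : (w.toFinset.filter (· < a)).Nonempty := Finset.card_pos.1 (by omega)
    have hb := Finset.max'_mem _ hne
    have hmax : ∀ x ∈ w.toFinset.filter (· < a), x ≤ (w.toFinset.filter (· < a)).max' hne :=
      fun x hx => Finset.le_max' _ x hx
    generalize (w.toFinset.filter (· < a)).max' hne = b at hb hmax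
    simp only [Finset.mem_filter, List.mem_toFinset] at hb hmax
    refine List.mem_map.2 ⟨b, hb.1, ?_⟩
    rw [← hcard]
    congr 1
    ext x
    simp only [Finset.mem_filter, List.mem_toFinset]
    exact ⟨fun h => ⟨h.1, h.2.trans_lt hb.2⟩, fun h => ⟨h.1, hmax x h⟩⟩

/-- The packing of a word, as a packed word. -/
def pack (w : List ℕ) : PackedWord := ⟨packList w, isPacked_packList w⟩

/-- The empty packed word. -/
def emptyWord : PackedWord := ⟨[], by constructor <;> simp⟩

section

variable (K : Type*) [Field K]

/-- The coproduct of the Hopf algebra of packed words in the basis `F` (whose unit is `F_ε` and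
whose product is the shifted shuffle):
`Δ(F_u) = ∑ F_{pack u(1,p)} ⊗ F_{pack u(p+1,n)}`,
over the `p` with `0 ≤ p ≤ n` such that `u(1,p)` and `u(p+1,n)` have no common letter.
On permutations this is the usual coproduct of `FQSym`. In the basis
`H_u = ∑ F_v` (over the packed words `v` such that `v(i) < v(j)` whenever `u(i) < u(j)`, and
`v(i) ≤ v(j)` whenever `u(i) = u(j)` and `i < j`), it is the full deconcatenation
`Δ(H_u) = ∑_{0 ≤ p ≤ n} H_{pack u(1,p)} ⊗ H_{pack u(p+1,n)}`, so that `H` is the dual of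
the basis of the word quasi-symmetric functions `∑_{pack w = u} w`. -/
noncomputable def comul : WQSym K →ₗ[K] WQSym K ⊗[K] WQSym K :=
  Finsupp.linearCombination K fun u =>
    ∑ p ∈ (Finset.range (u.1.length + 1)).filter
        (fun p => ∀ a ∈ u.1.take p, a ∉ u.1.drop p),
      F K (pack (u.1.take p)) ⊗ₜ[K] F K (pack (u.1.drop p))

/-- Zie elements are the primitive elements: `Δ(x) = x ⊗ 1 + 1 ⊗ x`, with `1 = F_ε`. -/
def IsZie (x : WQSym K) : Prop :=
  comul K x = x ⊗ₜ[K] F K emptyWord + F K emptyWord ⊗ₜ[K] x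

end

end PAsRight

open PAsRight

namespace PAsRight

/-! ### Letters of packed words -/

/-! Bracketing with `F_{id_s}` on the right is a single linear operator `D_s = T_s - B_s`. Since
`M_12 = F_12 - F_21`, the bracket sends `F_u` to `F_{u·t^s} - F_{u⁺·1^s}`, where `t = max u + 1` and
`u⁺` is `u` with all letters raised by one (`bracket_idWord`). Both claims are inductions on the
number of blocks, applying one `D_s` at a time.

Expansion: write `(v, a)` for `v` with a final block of `s` new letters inserted at value `a`. Going
up in the left weak order, such a block can only decrease in value, independently of the rest of the
word. Hence the upper set of `(u, t)` is the product of the upper set of `u` with `[1, t]`, and that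
of `(u, 1)` is the upper set of `u` (`upper_insertLast_top`, `upper_insertLast_one`). By
triangularity `T_s M_u = ∑_{1 ≤ a ≤ t} M_(u,a)` and `B_s M_u = M_(u,1)`, so `D_s M_u = ∑_{2 ≤ a ≤ t}
M_(u,a)`. Requiring `a ≥ 2` at every step says exactly that the letter `1` is used by the initial
block alone.

Primitivity: a cut inside the new block is forbidden, so `T_s` and `B_s` both satisfy `Δ(L x) = (id
⊗ L) Δ(x) + L x ⊗ 1` (`comul_append`), and so does `D_s`. As `D_s(1) = 0`, the operator `D_s`
preserves primitive elements; and `F_{id_r}` is primitive. -/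

theorem IsPacked.mem_iff {w : List ℕ} (hw : IsPacked w) {a : ℕ} :
    a ∈ w ↔ 1 ≤ a ∧ a ≤ maxLetter w := by
  refine ⟨fun h => ⟨hw.1 a h, le_maxLetter h⟩, fun ⟨h1, h2⟩ => ?_⟩
  have h0 : w ≠ [] := by
    rintro rfl
    simp [maxLetter] at h2
    omega
  exact hw.mem_of_le (maxLetter_mem h0) h1 h2

theorem maxLetter_congr {v w : List ℕ} (h : ∀ a, a ∈ v ↔ a ∈ w) : maxLetter v = maxLetter w := by
  have key : ∀ {v w : List ℕ}, (∀ a ∈ v, a ∈ w) → maxLetter v ≤ maxLetter w := by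
    intro v w h
    rcases eq_or_ne v [] with rfl | hv
    · simp [maxLetter]
    · exact le_maxLetter (h _ (maxLetter_mem hv))
  exact le_antisymm (key fun a => (h a).1) (key fun a => (h a).2)

/-! ### The covers of the left weak order -/

/-- All occurrences of `x` in `w` come before all occurrences of `y`. -/
def AllBefore (w : List ℕ) (x y : ℕ) : Prop :=
  w.Pairwise fun a b => ¬(a = y ∧ b = x)

theorem mem_leftInv {w : List ℕ} {i j : ℕ} :
    (i, j) ∈ leftInv w ↔ i ∈ w ∧ j ∈ w ∧ i < j ∧ AllBefore w j i := by
  simp only [leftInv, Finset.mem_filter, Finset.mem_product, List.mem_toFinset, AllBefore,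
    List.pairwise_iff_getElem, and_assoc]
  refine and_congr_right fun _ => and_congr_right fun _ => and_congr_right fun hij => ?_
  constructor
  · rintro h p q hp hq hpq ⟨h1, h2⟩
    have := h ⟨p, hp⟩ ⟨q, hq⟩ h1 h2
    simp only [Fin.mk_lt_mk] at this
    omega
  · rintro h ⟨p, hp⟩ ⟨q, hq⟩ h1 h2
    simp only [Fin.getElem_fin] at h1 h2
    rw [Fin.mk_lt_mk]
    by_contra hc
    rcases (not_lt.1 hc).eq_or_lt with rfl | hlt
    · omega
    · exact h p q hp hq hlt ⟨h1, h2⟩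

theorem AllBefore.not_symm {w : List ℕ} {x y : ℕ} (hx : x ∈ w) (hy : y ∈ w) (hxy : x ≠ y)
    (h : AllBefore w x y) : ¬AllBefore w y x := by
  intro h'
  obtain ⟨p, hp, rfl⟩ := List.getElem_of_mem hx
  obtain ⟨q, hq, rfl⟩ := List.getElem_of_mem hy
  rw [AllBefore, List.pairwise_iff_getElem] at h h'
  rcases lt_trichotomy p q with hpq | rfl | hpq
  · exact h' p q hp hq hpq ⟨rfl, rfl⟩
  · exact hxy rfl
  · exact h q p hq hp hpq ⟨rfl, rfl⟩

theorem allBefore_map_equiv (σ : Equiv.Perm ℕ) {w : List ℕ} {x y : ℕ} :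
    AllBefore (w.map σ) (σ x) (σ y) ↔ AllBefore w x y := by
  simp [AllBefore, List.pairwise_map]

theorem mem_map_swap {w : List ℕ} {i : ℕ} (hi : i ∈ w) (hi' : i + 1 ∈ w) (a : ℕ) :
    a ∈ w.map (Equiv.swap i (i + 1)) ↔ a ∈ w := by
  have h : a ∈ w.map (Equiv.swap i (i + 1)) ↔ Equiv.swap i (i + 1) a ∈ w := by
    rw [List.mem_map]
    constructor
    · rintro ⟨b, hb, rfl⟩
      simpa using hb
    · intro h
      exact ⟨_, h, by simp⟩
  rw [h, Equiv.swap_apply_def]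
  split_ifs with h1 h2
  · simp [h1, hi, hi']
  · simp [h2, hi, hi']
  · rfl

/-- The swap of `i` and `i + 1` preserves the order of every pair of letters except `(i, i + 1)`
itself, so it is a bijection between the remaining left-inversions of the two words. The count
therefore grows by one exactly when `(i, i + 1)` becomes an inversion. This replaces counting by a
local condition. -/
theorem leftCover_iff {u v : PackedWord} : LeftCover u v ↔
    ∃ i, i ∈ u.1 ∧ i + 1 ∈ u.1 ∧ v.1 = u.1.map (Equiv.swap i (i + 1)) ∧
      AllBefore u.1 i (i + 1) := by
  refine exists_congr fun i => and_congr_right fun hi => and_congr_right fun hi' =>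
    and_congr_right fun hv => ?_
  rw [hv]
  have hmem := mem_map_swap hi hi'
  set σ := Equiv.swap i (i + 1) with hσ
  have hσi : σ i = i + 1 := Equiv.swap_apply_left _ _
  have hσi' : σ (i + 1) = i := Equiv.swap_apply_right _ _
  have hinv : ∀ a, σ (σ a) = a := by simp [hσ]
  have hlt : ∀ a b, a < b → (a, b) ≠ (i, i + 1) → σ a < σ b ∧ (σ a, σ b) ≠ (i, i + 1) := by
    intro a b hab hne
    simp only [ne_eq, Prod.mk.injEq, hσ, Equiv.swap_apply_def] at hne ⊢
    split_ifs <;> omega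
  have hmap : ∀ {a}, a ∈ u.1 → σ a ∈ u.1 := fun {a} ha =>
    (hmem _).1 (List.mem_map_of_mem ha)
  have hcard : ((leftInv u.1).erase (i, i + 1)).card =
      ((leftInv (u.1.map σ)).erase (i, i + 1)).card := by
    refine Finset.card_bij (fun x _ => (σ x.1, σ x.2)) ?_ ?_ ?_
    · rintro ⟨a, b⟩ hab
      rw [Finset.mem_erase, mem_leftInv] at hab ⊢
      obtain ⟨hne, ha, hb, h, hB⟩ := hab
      exact ⟨(hlt a b h hne).2, (hmem _).2 (hmap ha), (hmem _).2 (hmap hb), (hlt a b h hne).1,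
        (allBefore_map_equiv σ).2 hB⟩
    · rintro ⟨a, b⟩ _ ⟨a', b'⟩ _ h
      simpa using h
    · rintro ⟨a, b⟩ hab
      rw [Finset.mem_erase, mem_leftInv] at hab
      obtain ⟨hne, ha, hb, h, hB⟩ := hab
      refine ⟨(σ a, σ b), ?_, by simp [hinv]⟩
      rw [Finset.mem_erase, mem_leftInv]
      refine ⟨(hlt a b h hne).2, hmap ((hmem _).1 ha), hmap ((hmem _).1 hb), (hlt a b h hne).1, ?_⟩
      rw [← allBefore_map_equiv σ, hinv, hinv]
      exact hB
  have hB : AllBefore (u.1.map σ) (i + 1) i ↔ AllBefore u.1 i (i + 1) := by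
    rw [← allBefore_map_equiv σ, hσi, hσi', List.map_map]
    simp [Function.comp_def, hinv]
  have hm : (i, i + 1) ∈ leftInv (u.1.map σ) ↔ AllBefore u.1 i (i + 1) := by
    rw [mem_leftInv, hmem, hmem, hB]
    simp [hi, hi']
  have hm' : (i, i + 1) ∈ leftInv u.1 → ¬AllBefore u.1 i (i + 1) := by
    rw [mem_leftInv]
    rintro ⟨-, -, -, h⟩
    exact h.not_symm hi' hi (by omega)
  by_cases h : AllBefore u.1 i (i + 1)
  · have h1 := Finset.card_erase_add_one (hm.2 h)
    have h2 := Finset.erase_eq_of_notMem (fun h' => hm' h' h)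
    rw [h2] at hcard
    simp only [h, iff_true]
    omega
  · have h1 := Finset.erase_eq_of_notMem (fun h' => h (hm.1 h'))
    have h2 := Finset.card_erase_le (s := leftInv u.1) (a := (i, i + 1))
    rw [h1] at hcard
    simp only [h, iff_false]
    omega

theorem LeftLE.mem_iff {u v : PackedWord} (h : LeftLE u v) (a : ℕ) : a ∈ v.1 ↔ a ∈ u.1 := by
  induction h with
  | refl => rfl
  | tail _ h ih =>
    obtain ⟨i, hi, hi', hw, -⟩ := h
    rw [hw, mem_map_swap hi hi', ih]

theorem LeftLE.maxLetter_eq {u v : PackedWord} (h : LeftLE u v) :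
    maxLetter v.1 = maxLetter u.1 :=
  maxLetter_congr h.mem_iff

theorem LeftLE.length_eq {u v : PackedWord} (h : LeftLE u v) : v.1.length = u.1.length := by
  induction h with
  | refl => rfl
  | tail _ h ih =>
    obtain ⟨i, -, -, hw, -⟩ := h
    rw [hw, List.length_map, ih]

/-! ### Appending a block of equal new letters -/

/-- The word `w`, with its letters `≥ a` incremented, followed by `s` copies of `a`. -/
def blockAppend (s a : ℕ) (w : List ℕ) : List ℕ :=
  w.map (fun x => if a ≤ x then x + 1 else x) ++ List.replicate s a

theorem mem_blockAppend {s a : ℕ} {w : List ℕ} (hs : 1 ≤ s) (hw : IsPacked w) (ha : 1 ≤ a)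
    (ha' : a ≤ maxLetter w + 1) {x : ℕ} :
    x ∈ blockAppend s a w ↔ 1 ≤ x ∧ x ≤ maxLetter w + 1 := by
  simp only [blockAppend, List.mem_append, List.mem_map, List.mem_replicate, hw.mem_iff]
  constructor
  · rintro (⟨y, ⟨h1, h2⟩, rfl⟩ | ⟨-, rfl⟩)
    · split_ifs <;> omega
    · omega
  · rintro ⟨h1, h2⟩
    rcases lt_trichotomy x a with h | h | h
    · exact Or.inl ⟨x, by omega, by split_ifs <;> omega⟩
    · exact Or.inr (by omega)
    · exact Or.inl ⟨x - 1, by omega, by split_ifs <;> omega⟩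

theorem isPacked_blockAppend {s a : ℕ} {w : List ℕ} (hs : 1 ≤ s) (hw : IsPacked w) (ha : 1 ≤ a)
    (ha' : a ≤ maxLetter w + 1) : IsPacked (blockAppend s a w) := by
  constructor
  · intro x hx
    exact ((mem_blockAppend hs hw ha ha').1 hx).1
  · intro x h1 hx
    rw [mem_blockAppend hs hw ha ha'] at hx ⊢
    omega

open Classical in
/-- The packed word `blockAppend s a u` (for `s ≥ 1` and `1 ≤ a ≤ maxLetter u + 1`). -/
noncomputable def insertLast (s a : ℕ) (u : PackedWord) : PackedWord :=
  -- The fallback is never reached for `s ≥ 1` and `1 ≤ a ≤ maxLetter u + 1`, by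
  -- `isPacked_blockAppend`.
  if h : IsPacked (blockAppend s a u.1) then ⟨_, h⟩ else emptyWord

theorem insertLast_val {s a : ℕ} {u : PackedWord} (hs : 1 ≤ s) (ha : 1 ≤ a)
    (ha' : a ≤ maxLetter u.1 + 1) : (insertLast s a u).1 = blockAppend s a u.1 := by
  rw [insertLast, dif_pos (isPacked_blockAppend hs u.2 ha ha')]

theorem blockAppend_top {s : ℕ} {w : List ℕ} :
    blockAppend s (maxLetter w + 1) w = w ++ List.replicate s (maxLetter w + 1) := by
  rw [blockAppend]
  congr 1
  conv_rhs => rw [← List.map_id w]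
  refine List.map_congr_left fun x hx => ?_
  have := le_maxLetter hx
  rw [if_neg (by omega), id]

theorem blockAppend_one {s : ℕ} {w : List ℕ} (hw : IsPacked w) :
    blockAppend s 1 w = w.map (· + 1) ++ List.replicate s 1 := by
  rw [blockAppend]
  congr 1
  refine List.map_congr_left fun x hx => ?_
  rw [if_pos (hw.1 x hx)]

theorem blockAppend_injective {s a b : ℕ} {v w : List ℕ} (hs : 1 ≤ s)
    (h : blockAppend s a v = blockAppend s b w) : a = b ∧ v = w := by
  obtain ⟨h1, h2⟩ := List.append_inj' h (by simp)
  obtain rfl : a = b := by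
    have : a ∈ List.replicate s b := h2 ▸ List.mem_replicate.2 ⟨by omega, rfl⟩
    exact (List.mem_replicate.1 this).2
  refine ⟨rfl, List.map_injective_iff.2 (fun x y hxy => ?_) h1⟩
  split_ifs at hxy <;> omega

/-! ### Covers and upper sets of words with an appended block -/

theorem leftCover_insertLast_one {s : ℕ} {u v : PackedWord} (hs : 1 ≤ s) (h : LeftCover u v) :
    LeftCover (insertLast s 1 u) (insertLast s 1 v) := by
  obtain ⟨i, hi, hi', hv, hB⟩ := leftCover_iff.1 h
  have h1 := u.2.mem_iff.1 hi
  have h2 := u.2.mem_iff.1 hi'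
  rw [leftCover_iff, insertLast_val hs le_rfl (by omega), insertLast_val hs le_rfl (by omega)]
  refine ⟨i + 1, ?_, ?_, ?_, ?_⟩
  · rw [mem_blockAppend hs u.2 le_rfl (by omega)]; omega
  · rw [mem_blockAppend hs u.2 le_rfl (by omega)]; omega
  · rw [blockAppend_one u.2, blockAppend_one v.2, hv]
    simp only [List.map_append, List.map_map, List.map_replicate]
    congr 1
    · refine List.map_congr_left fun x hx => ?_
      simp only [Function.comp_apply, Equiv.swap_apply_def]
      split_ifs <;> omega
    · rw [Equiv.swap_apply_def]
      congr 1
      split_ifs <;> omega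
  · rw [blockAppend_one u.2, AllBefore, List.pairwise_append, List.pairwise_map]
    refine ⟨hB.imp fun h => by omega, ?_, ?_⟩
    · rw [List.pairwise_replicate]; omega
    · intro x _ y hy
      have := (List.mem_replicate.1 hy).2
      omega

theorem leftCover_insertLast_top {s : ℕ} {u v : PackedWord} (hs : 1 ≤ s) (h : LeftCover u v) :
    LeftCover (insertLast s (maxLetter u.1 + 1) u) (insertLast s (maxLetter v.1 + 1) v) := by
  have hmax : maxLetter v.1 = maxLetter u.1 := LeftLE.maxLetter_eq (Relation.ReflTransGen.single h)
  obtain ⟨i, hi, hi', hv, hB⟩ := leftCover_iff.1 h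
  have h1 := u.2.mem_iff.1 hi
  have h2 := u.2.mem_iff.1 hi'
  rw [leftCover_iff, insertLast_val hs (by omega) le_rfl, insertLast_val hs (by omega) le_rfl]
  refine ⟨i, ?_, ?_, ?_, ?_⟩
  · rw [mem_blockAppend hs u.2 (by omega) le_rfl]; omega
  · rw [mem_blockAppend hs u.2 (by omega) le_rfl]; omega
  · rw [blockAppend_top, blockAppend_top, hmax, List.map_append, List.map_replicate, ← hv,
      Equiv.swap_apply_of_ne_of_ne (by omega) (by omega)]
  · rw [blockAppend_top, AllBefore, List.pairwise_append]
    refine ⟨hB, ?_, ?_⟩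
    · rw [List.pairwise_replicate]; omega
    · intro x _ y hy
      have := (List.mem_replicate.1 hy).2
      omega

/-- With the block at value `a + 1`, the letter `a` occurs only before the block and `a + 1` only in
it, so the block may slide down by one. -/
theorem leftCover_insertLast_pred {s a : ℕ} {u : PackedWord} (hs : 1 ≤ s) (ha : 1 ≤ a)
    (ha' : a ≤ maxLetter u.1) : LeftCover (insertLast s (a + 1) u) (insertLast s a u) := by
  rw [leftCover_iff, insertLast_val hs (by omega) (by omega), insertLast_val hs ha (by omega)]
  refine ⟨a, ?_, ?_, ?_, ?_⟩
  · rw [mem_blockAppend hs u.2 (by omega) (by omega)]; omega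
  · rw [mem_blockAppend hs u.2 (by omega) (by omega)]; omega
  · simp only [blockAppend, List.map_append, List.map_map, List.map_replicate,
      Equiv.swap_apply_right]
    congr 1
    refine List.map_congr_left fun x hx => ?_
    simp only [Function.comp_apply, Equiv.swap_apply_def]
    split_ifs <;> omega
  · rw [blockAppend, AllBefore, List.pairwise_append, List.pairwise_map]
    refine ⟨List.pairwise_of_forall fun {x y} => ?_, ?_, ?_⟩
    · split_ifs <;> omega
    · rw [List.pairwise_replicate]; omega
    · intro x _ y hy
      have := (List.mem_replicate.1 hy).2
      omega

/-- A swap that avoids the value `a` is a cover of `u`; a swap of `a - 1` and `a` slides the block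
down; a swap of `a` and `a + 1` is impossible, because the block comes last. -/
theorem LeftCover.of_insertLast {s a : ℕ} {u w : PackedWord} (hs : 1 ≤ s) (ha : 1 ≤ a)
    (ha' : a ≤ maxLetter u.1 + 1) (h : LeftCover (insertLast s a u) w) :
    ∃ v b, LeftLE u v ∧ 1 ≤ b ∧ b ≤ a ∧ w = insertLast s b v := by
  obtain ⟨i, hi, hi', hw, hB⟩ := leftCover_iff.1 h
  rw [insertLast_val hs ha ha'] at hi hi' hw hB
  rw [mem_blockAppend hs u.2 ha ha'] at hi hi'
  have key : ∀ j, 1 ≤ j → j + 1 ≤ maxLetter u.1 → AllBefore u.1 j (j + 1) →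
      w.1 = blockAppend s a (u.1.map (Equiv.swap j (j + 1))) →
      ∃ v b, LeftLE u v ∧ 1 ≤ b ∧ b ≤ a ∧ w = insertLast s b v := by
    intro j hj hj' hBj hwj
    have m1 : j ∈ u.1 := u.2.mem_iff.2 ⟨hj, by omega⟩
    have m2 : j + 1 ∈ u.1 := u.2.mem_iff.2 ⟨by omega, hj'⟩
    have hmem := mem_map_swap m1 m2
    have hp : IsPacked (u.1.map (Equiv.swap j (j + 1))) := by
      constructor
      · intro x hx
        exact u.2.1 x ((hmem x).1 hx)
      · intro x h1 hx
        exact (hmem x).2 (u.2.2 x h1 ((hmem _).1 hx))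
    have hm := maxLetter_congr hmem
    refine ⟨⟨_, hp⟩, a, Relation.ReflTransGen.single
      (leftCover_iff.2 ⟨j, m1, m2, rfl, hBj⟩), ha, le_rfl, Subtype.ext ?_⟩
    rw [insertLast_val hs ha (by simpa only [hm] using ha'), hwj]
  have hB1 := (List.pairwise_append.1 hB).1
  have hB3 := (List.pairwise_append.1 hB).2.2
  rw [List.pairwise_map] at hB1
  rcases lt_trichotomy (i + 1) a with hia | hia | hia
  · refine key i hi.1 (by omega) (hB1.imp fun {x y} h => ?_) ?_
    · rintro ⟨rfl, rfl⟩
      exact h ⟨by split_ifs <;> omega, by split_ifs <;> omega⟩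
    · rw [hw]
      simp only [blockAppend, List.map_append, List.map_map, List.map_replicate]
      congr 1
      · refine List.map_congr_left fun x hx => ?_
        simp only [Function.comp_apply, Equiv.swap_apply_def]
        split_ifs <;> omega
      · rw [Equiv.swap_apply_of_ne_of_ne (by omega) (by omega)]
  · refine ⟨u, i, Relation.ReflTransGen.refl, hi.1, by omega, Subtype.ext ?_⟩
    rw [insertLast_val hs hi.1 (by omega), hw, ← hia]
    simp only [blockAppend, List.map_append, List.map_map, List.map_replicate,
      Equiv.swap_apply_right]
    congr 1
    refine List.map_congr_left fun x hx => ?_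
    simp only [Function.comp_apply, Equiv.swap_apply_def]
    split_ifs <;> omega
  · rcases (Nat.lt_succ_iff.1 hia).eq_or_lt with rfl | hia
    · exact absurd ⟨rfl, rfl⟩ (hB3 (a + 1)
        (List.mem_map.2 ⟨a, u.2.mem_iff.2 ⟨ha, by omega⟩, by simp⟩) a
        (List.mem_replicate.2 ⟨by omega, rfl⟩))
    -- Above the block, the letters `i` and `i + 1` come from the letters `i - 1` and `i` of `u`.
    · obtain ⟨j, rfl⟩ : ∃ j, i = j + 1 := ⟨i - 1, by omega⟩
      refine key j (by omega) (by omega) (hB1.imp fun {x y} h => ?_) ?_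
      · rintro ⟨rfl, rfl⟩
        exact h ⟨by split_ifs <;> omega, by split_ifs <;> omega⟩
      · rw [hw]
        simp only [blockAppend, List.map_append, List.map_map, List.map_replicate]
        congr 1
        · refine List.map_congr_left fun x hx => ?_
          simp only [Function.comp_apply, Equiv.swap_apply_def]
          split_ifs <;> omega
        · rw [Equiv.swap_apply_of_ne_of_ne (by omega) (by omega)]

theorem LeftLE.of_insertLast {s a : ℕ} {u w : PackedWord} (hs : 1 ≤ s) (ha : 1 ≤ a)
    (ha' : a ≤ maxLetter u.1 + 1) (h : LeftLE (insertLast s a u) w) :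
    ∃ v b, LeftLE u v ∧ 1 ≤ b ∧ b ≤ a ∧ w = insertLast s b v := by
  induction h with
  | refl => exact ⟨u, a, Relation.ReflTransGen.refl, ha, le_rfl, rfl⟩
  | tail _ h ih =>
    obtain ⟨v, b, huv, hb, hba, rfl⟩ := ih
    have hm := huv.maxLetter_eq
    obtain ⟨v', b', h1, h2, h3, h4⟩ := h.of_insertLast hs hb (by omega)
    exact ⟨v', b', huv.trans h1, h2, h3.trans hba, h4⟩

/-- A chain from `u` to `v` can be followed while the block stays on top; the block then slides down
to `b` one cover at a time. -/
theorem leftLE_insertLast_top {s b : ℕ} {u v : PackedWord} (hs : 1 ≤ s) (h : LeftLE u v)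
    (hb : 1 ≤ b) (hb' : b ≤ maxLetter u.1 + 1) :
    LeftLE (insertLast s (maxLetter u.1 + 1) u) (insertLast s b v) := by
  have h1 : LeftLE (insertLast s (maxLetter u.1 + 1) u)
      (insertLast s (maxLetter v.1 + 1) v) := by
    clear hb'
    induction h with
    | refl => exact Relation.ReflTransGen.refl
    | tail _ h ih => exact ih.tail (leftCover_insertLast_top hs h)
  have hm := h.maxLetter_eq
  obtain ⟨d, hd⟩ := Nat.exists_eq_add_of_le hb'
  refine h1.trans ?_
  rw [hm, hd]
  clear h1
  induction d generalizing b with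
  | zero => exact Relation.ReflTransGen.refl
  | succ d ih =>
    have h2 := ih (b := b + 1) (by omega) (by omega) (by omega)
    rw [show b + 1 + d = b + (d + 1) by omega] at h2
    exact h2.tail (leftCover_insertLast_pred hs hb (by omega))

theorem leftLE_insertLast_one {s : ℕ} {u v : PackedWord} (hs : 1 ≤ s) (h : LeftLE u v) :
    LeftLE (insertLast s 1 u) (insertLast s 1 v) := by
  induction h with
  | refl => exact Relation.ReflTransGen.refl
  | tail _ h ih => exact ih.tail (leftCover_insertLast_one hs h)

theorem insertLast_injective {s a b : ℕ} {u v : PackedWord} (hs : 1 ≤ s) (ha : 1 ≤ a)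
    (ha' : a ≤ maxLetter u.1 + 1) (hb : 1 ≤ b) (hb' : b ≤ maxLetter v.1 + 1)
    (h : insertLast s a u = insertLast s b v) : a = b ∧ u = v := by
  have h1 := congrArg Subtype.val h
  rw [insertLast_val hs ha ha', insertLast_val hs hb hb'] at h1
  exact ⟨(blockAppend_injective hs h1).1, Subtype.ext (blockAppend_injective hs h1).2⟩

open Classical in
-- This product structure is the combinatorial core of the expansion.
theorem upper_insertLast_top {s : ℕ} (hs : 1 ≤ s) (u : PackedWord) :
    upper (insertLast s (maxLetter u.1 + 1) u) =
      (upper u ×ˢ Finset.Icc 1 (maxLetter u.1 + 1)).image fun x => insertLast s x.2 x.1 := by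
  ext w
  simp only [mem_upper, Finset.mem_image, Finset.mem_product, Finset.mem_Icc, Prod.exists]
  constructor
  · intro h
    obtain ⟨v, b, h1, h2, h3, rfl⟩ := h.of_insertLast hs (by omega) le_rfl
    exact ⟨v, b, ⟨h1, h2, h3⟩, rfl⟩
  · rintro ⟨v, b, ⟨h1, h2, h3⟩, rfl⟩
    exact leftLE_insertLast_top hs h1 h2 h3

theorem insertLast_injOn {s : ℕ} (hs : 1 ≤ s) (u : PackedWord) :
    Set.InjOn (fun x : PackedWord × ℕ => insertLast s x.2 x.1)
      (upper u ×ˢ Finset.Icc 1 (maxLetter u.1 + 1) : Finset (PackedWord × ℕ)) := by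
  rintro ⟨v, a⟩ hv ⟨v', a'⟩ hv' h
  simp only [Finset.coe_product, Set.mem_prod, Finset.mem_coe, mem_upper, Finset.mem_Icc] at hv hv'
  dsimp only at h hv hv'
  have h1 : maxLetter v.1 = maxLetter u.1 := hv.1.maxLetter_eq
  have h2 : maxLetter v'.1 = maxLetter u.1 := hv'.1.maxLetter_eq
  obtain ⟨rfl, rfl⟩ := insertLast_injective hs hv.2.1 (by omega) hv'.2.1 (by omega) h
  rfl

open Classical in
theorem upper_insertLast_one {s : ℕ} (hs : 1 ≤ s) (u : PackedWord) :
    upper (insertLast s 1 u) = (upper u).image (insertLast s 1) := by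
  ext w
  simp only [mem_upper, Finset.mem_image]
  constructor
  · intro h
    obtain ⟨v, b, h1, h2, h3, rfl⟩ := h.of_insertLast hs le_rfl (by omega)
    obtain rfl : b = 1 := by omega
    exact ⟨v, h1, rfl⟩
  · rintro ⟨v, h1, rfl⟩
    exact leftLE_insertLast_one hs h1

theorem insertLast_one_injective {s : ℕ} (hs : 1 ≤ s) : Function.Injective (insertLast s 1) :=
  fun _ _ h => (insertLast_injective hs le_rfl (by omega) le_rfl (by omega) h).2

end PAsRight

namespace PAsRight

/-! ### The operation of appending a block, on both bases -/

section

variable (K : Type*) [Field K]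

/-- The linear map sending `F_u` to `F_{u · 1 ⋯ 1}`, with the letters of the new block made
greater than those of `u`. -/
noncomputable def appendTop (s : ℕ) : WQSym K →ₗ[K] WQSym K :=
  Finsupp.linearCombination K fun u => F K (insertLast s (maxLetter u.1 + 1) u)

/-- The linear map sending `F_u` to `F_{u · 1 ⋯ 1}`, with the letters of the new block made
less than those of `u`. -/
noncomputable def appendBottom (s : ℕ) : WQSym K →ₗ[K] WQSym K :=
  Finsupp.linearCombination K fun u => F K (insertLast s 1 u)

theorem appendTop_F (s : ℕ) (u : PackedWord) :
    appendTop K s (F K u) = F K (insertLast s (maxLetter u.1 + 1) u) := by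
  simp [appendTop, F]

theorem appendBottom_F (s : ℕ) (u : PackedWord) :
    appendBottom K s (F K u) = F K (insertLast s 1 u) := by
  simp [appendBottom, F]

/-- Induction from the maximal words downwards, on the size of the upper set. -/
theorem M_induction {P : PackedWord → Prop}
    (h : ∀ u, (∀ v, LeftLE u v → v ≠ u → P v) → P u) (u : PackedWord) : P u := by
  induction hn : (upper u).card using Nat.strong_induction_on generalizing u with
  | _ n ih =>
    subst hn
    exact h u fun v huv hne => ih _ (card_upper_lt huv hne) v rfl

open Classical in
-- Unitriangularity of the change of basis. It lets a formula on the `M_u` be checked after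
-- summation over upper sets, that is, on the `F_u`.
theorem eq_of_sum_upper_eq {A : Type*} [AddCommGroup A] {f g : PackedWord → A}
    (h : ∀ u, ∑ v ∈ upper u, f v = ∑ v ∈ upper u, g v) (u : PackedWord) : f u = g u := by
  induction u using M_induction with
  | _ u ih =>
    have hu : u ∈ upper u := mem_upper.2 Relation.ReflTransGen.refl
    have h1 := h u
    rw [← Finset.add_sum_erase _ _ hu, ← Finset.add_sum_erase _ _ hu] at h1
    rw [Finset.sum_congr rfl fun v hv => ih v (mem_upper.1 (Finset.mem_of_mem_erase hv))
      (Finset.ne_of_mem_erase hv)] at h1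
    exact add_right_cancel h1

theorem appendTop_M {s : ℕ} (hs : 1 ≤ s) (u : PackedWord) :
    appendTop K s (M K u) =
      ∑ a ∈ Finset.Icc 1 (maxLetter u.1 + 1), M K (insertLast s a u) := by
  classical
  refine eq_of_sum_upper_eq (f := fun u => appendTop K s (M K u))
    (g := fun u => ∑ a ∈ Finset.Icc 1 (maxLetter u.1 + 1), M K (insertLast s a u))
    (fun u => ?_) u
  rw [← map_sum, ← F_eq_sum_M, appendTop_F, F_eq_sum_M, upper_insertLast_top hs,
    Finset.sum_image (insertLast_injOn hs u), Finset.sum_product]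
  refine Finset.sum_congr rfl fun v hv => ?_
  rw [(mem_upper.1 hv).maxLetter_eq]

theorem appendBottom_M {s : ℕ} (hs : 1 ≤ s) (u : PackedWord) :
    appendBottom K s (M K u) = M K (insertLast s 1 u) := by
  classical
  refine eq_of_sum_upper_eq (f := fun u => appendBottom K s (M K u))
    (g := fun u => M K (insertLast s 1 u)) (fun u => ?_) u
  rw [← map_sum, ← F_eq_sum_M, appendBottom_F, F_eq_sum_M, upper_insertLast_one hs,
    Finset.sum_image (insertLast_one_injective hs).injOn]

/-- The bottom insertion cancels exactly the term `a = 1` of the top one. -/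
theorem appendTop_sub_appendBottom_M {s : ℕ} (hs : 1 ≤ s) (u : PackedWord) :
    (appendTop K s - appendBottom K s) (M K u) =
      ∑ a ∈ Finset.Icc 2 (maxLetter u.1 + 1), M K (insertLast s a u) := by
  rw [LinearMap.sub_apply, appendTop_M K hs, appendBottom_M K hs,
    ← Finset.add_sum_Ioc_eq_sum_Icc (by omega), add_sub_cancel_left]
  rfl

/-! ### The elements `F_{id_r}` and the bracket with them -/

open Classical in
theorem upper_idWord (r : ℕ) : upper (idWord r) = {idWord r} := by
  ext v
  rw [mem_upper, Finset.mem_singleton]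
  constructor
  · intro h
    rcases Relation.ReflTransGen.cases_head h with h0 | ⟨w, ⟨i, hi, hi', -⟩, -⟩
    · exact h0.symm
    · have h1 := List.eq_of_mem_replicate hi
      have h2 := List.eq_of_mem_replicate hi'
      omega
  · rintro rfl
    exact Relation.ReflTransGen.refl

theorem F_idWord (r : ℕ) : F K (idWord r) = M K (idWord r) := by
  classical
  rw [F_eq_sum_M, upper_idWord, Finset.sum_singleton]

theorem maxLetter_replicate {r a : ℕ} (hr : 1 ≤ r) : maxLetter (List.replicate r a) = a := by
  have h : List.replicate r a ≠ [] := by simp; omega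
  exact List.eq_of_mem_replicate (maxLetter_mem h)

/-- The packed word `21`. -/
def word21 : PackedWord := ⟨[2, 1], by
  refine ⟨by simp, fun a ha h => ?_⟩
  simp only [List.mem_cons, List.not_mem_nil, or_false] at h ⊢
  omega⟩

/-- The words `12` and `21` are the top and bottom insertions of one letter into the word `1`, so
this is an instance of `appendTop_sub_appendBottom_M`. -/
theorem M_word12 : M K word12 = F K word12 - F K word21 := by
  have hm : maxLetter (idWord 1).1 = 1 := maxLetter_replicate le_rfl
  have h := appendTop_sub_appendBottom_M K (s := 1) le_rfl (idWord 1)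
  have h12 : insertLast 1 2 (idWord 1) = word12 := Subtype.ext (by
    rw [insertLast_val le_rfl (by omega) (by omega)]; rfl)
  have h21 : insertLast 1 1 (idWord 1) = word21 := Subtype.ext (by
    rw [insertLast_val le_rfl (by omega) (by omega)]; rfl)
  rw [hm, ← F_idWord, LinearMap.sub_apply, appendTop_F, appendBottom_F, hm, h12, h21] at h
  simpa [h12] using h.symm

theorem circ_F (i : ℕ) {u v w : PackedWord} (hv : v.1 ≠ []) (h1 : 1 ≤ i) (hi : i ≤ u.1.length)
    (h : insertWord u.1 i v.1 = w.1) : circ K i (F K u) (F K v) = F K w := by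
  have hw : w = ⟨insertWord u.1 i v.1, isPacked_insertWord u.2 v.2 hv h1 hi⟩ :=
    Subtype.ext h.symm
  simp [circ, F, hv, h1, hi, hw]

theorem circ_F_emptyWord (i : ℕ) (x : WQSym K) : circ K i x (F K emptyWord) = 0 := by
  induction x using Finsupp.induction_linear with
  | zero => simp
  | add x y hx hy => simp [hx, hy]
  | single u r => simp [circ, F, emptyWord]

theorem emptyWord_insertLast_top (s : ℕ) :
    insertLast s (maxLetter emptyWord.1 + 1) emptyWord = insertLast s 1 emptyWord := rfl

/-- For the empty word, top and bottom are the same value `1`. Primitivity rests on this vanishing.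
-/
theorem appendTop_sub_appendBottom_emptyWord (s : ℕ) :
    (appendTop K s - appendBottom K s) (F K emptyWord) = 0 := by
  rw [LinearMap.sub_apply, appendTop_F, appendBottom_F, emptyWord_insertLast_top, sub_self]

theorem incr_eq_map {α β : ℕ} {w : List ℕ} {f : ℕ → ℕ}
    (h : ∀ x ∈ w, (if β < x then x + α else x) = f x) : incr α β w = w.map f :=
  List.map_congr_left h

theorem isPacked_one_replicate {r : ℕ} : IsPacked (1 :: List.replicate r 2) := by
  refine ⟨fun a ha => ?_, fun a h1 ha => ?_⟩
  · rw [List.mem_cons, List.mem_replicate] at ha; omega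
  · rw [List.mem_cons, List.mem_replicate] at ha ⊢; omega

theorem isPacked_two_replicate {r : ℕ} (hr : 1 ≤ r) : IsPacked (2 :: List.replicate r 1) := by
  refine ⟨fun a ha => ?_, fun a h1 ha => ?_⟩
  · rw [List.mem_cons, List.mem_replicate] at ha; omega
  · rw [List.mem_cons, List.mem_replicate] at ha ⊢; omega

/-- Inserting `id_s` at position 2 turns `12` and `21` into `1 2^s` and `2 1^s`; inserting `u` at
position 1 then leaves a block above, respectively below, all letters of `u`. -/
theorem bracket_idWord {s : ℕ} (hs : 1 ≤ s) (x : WQSym K) :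
    bracket K x (F K (idWord s)) = (appendTop K s - appendBottom K s) x := by
  have hid : (idWord s).1 ≠ [] := by simp [idWord]; omega
  have hmax : maxLetter (idWord s).1 = 1 := maxLetter_replicate hs
  have h12 : circ K 2 (F K word12) (F K (idWord s)) =
      F K ⟨1 :: List.replicate s 2, isPacked_one_replicate⟩ :=
    circ_F K 2 hid (by omega) le_rfl (by
      simp [insertWord, word12, idWord, incr])
  have h21 : circ K 2 (F K word21) (F K (idWord s)) =
      F K ⟨2 :: List.replicate s 1, isPacked_two_replicate hs⟩ :=
    circ_F K 2 hid (by omega) le_rfl (by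
      rw [insertWord, hmax]
      simp [word21, idWord, incr])
  rw [bracket, M_word12, map_sub, LinearMap.sub_apply, h12, h21]
  induction x using Finsupp.induction_linear with
  | zero => simp
  | add x y hx hy => rw [map_add, map_add, hx, hy]
  | single u r =>
    rw [← mul_one r, ← smul_eq_mul, ← Finsupp.smul_single, map_smul, map_smul]
    congr 1
    change _ = (appendTop K s - appendBottom K s) (F K u)
    change (circ K 1 _) (F K u) = _
    by_cases hu : u.1 = []
    -- On the degree zero component both sides vanish, the left one by the default value of `circ`.
    · obtain rfl : u = emptyWord := Subtype.ext hu
      rw [circ_F_emptyWord, appendTop_sub_appendBottom_emptyWord]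
    · have hpos : 1 ≤ maxLetter u.1 := u.2.1 _ (maxLetter_mem hu)
      rw [map_sub, LinearMap.sub_apply, LinearMap.sub_apply, appendTop_F, appendBottom_F]
      congr 1
      · refine circ_F K 1 hu le_rfl (by simp) ?_
        rw [insertLast_val hs (by omega) le_rfl, blockAppend_top]
        simp [insertWord, incr, show 2 + (maxLetter u.1 - 1) = maxLetter u.1 + 1 by omega]
      · refine circ_F K 1 hu le_rfl (by simp) ?_
        rw [insertLast_val hs le_rfl (by omega), blockAppend_one u.2]
        simp only [insertWord, incr]
        simp
        exact fun a ha h0 => by have := u.2.1 a ha; omega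

end

/-! ### Words starting with a block of ones -/

/-- A form in terms of prefix and suffix, which is easy to follow when a block is appended. -/
theorem startsWithBlock_iff {r : ℕ} {u : PackedWord} :
    StartsWithBlock r u ↔ u.1.take r = List.replicate r 1 ∧ ∀ x ∈ u.1.drop r, 2 ≤ x := by
  have key : ∀ w : List ℕ, IsPacked w → insertWord (List.replicate r 1 ++ [2]) (r + 1) w =
      List.replicate r 1 ++ w.map (· + 1) := by
    intro w hw
    have h1 : (List.replicate r 1 ++ [2]).getD r 0 = 2 := by
      simp [List.getD_eq_getElem?_getD]
    have h2 : (List.replicate r 1 ++ [2]).take r = List.replicate r 1 := by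
      simp
    have h3 : (List.replicate r 1 ++ [2]).drop (r + 1) = [] := by
      simp
    rw [insertWord, Nat.add_sub_cancel, h1, h2, h3]
    rw [incr_eq_map (f := (· + 1)) fun x hx => if_pos (hw.1 x hx)]
    simp [incr]
  constructor
  · rintro ⟨u', hu'⟩
    rw [key _ u'.2] at hu'
    rw [hu']
    refine ⟨by simp, fun x hx => ?_⟩
    rw [List.drop_left' (by simp), List.mem_map] at hx
    obtain ⟨y, hy, rfl⟩ := hx
    have := u'.2.1 y hy
    omega
  · rintro ⟨h1, h2⟩
    have hu : u.1 = List.replicate r 1 ++ u.1.drop r := by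
      rw [← h1, List.take_append_drop]
    have hp : IsPacked ((u.1.drop r).map (· - 1)) := by
      refine ⟨fun a ha => ?_, fun a ha ha' => ?_⟩
      · obtain ⟨x, hx, rfl⟩ := List.mem_map.1 ha
        have := h2 x hx
        omega
      · obtain ⟨x, hx, hxa⟩ := List.mem_map.1 ha'
        -- Here `x = a + 2`. Since `a + 1 ≥ 2`, this letter cannot lie in the initial block of ones,
        -- so it lies in the rest.
        have h3 : a + 1 ∈ u.1 := u.2.2 _ (by omega) (by
          rw [show a + 1 + 1 = x by omega]; exact List.mem_of_mem_drop hx)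
        rw [hu, List.mem_append, List.mem_replicate] at h3
        exact List.mem_map.2 ⟨a + 1, by
          rcases h3 with h3 | h3
          · omega
          · exact h3, rfl⟩
    refine ⟨⟨_, hp⟩, ?_⟩
    rw [key _ hp, List.map_map]
    conv_lhs => rw [hu, ← List.map_id (u.1.drop r)]
    congr 1
    refine List.map_congr_left fun x hx => ?_
    have := h2 x hx
    simp only [id, Function.comp_apply]
    omega

/-- A value `a ≥ 2` leaves the letters `1` of `u` unchanged, whereas `a = 1` puts ones at the end.
As `r ≤ u.1.length`, the prefix is read inside `u`. -/
theorem startsWithBlock_insertLast {r s a : ℕ} {u : PackedWord} (hs : 1 ≤ s)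
    (ha : 1 ≤ a) (ha' : a ≤ maxLetter u.1 + 1) (hu : r ≤ u.1.length) :
    StartsWithBlock r (insertLast s a u) ↔ StartsWithBlock r u ∧ 2 ≤ a := by
  rw [startsWithBlock_iff, startsWithBlock_iff, insertLast_val hs ha ha', blockAppend,
    List.take_append_of_le_length (by simpa using hu),
    List.drop_append_of_le_length (by simpa using hu), List.eq_replicate_iff,
    List.eq_replicate_iff, ← List.map_take, ← List.map_drop]
  simp only [List.length_map, List.mem_map, List.mem_append, List.mem_replicate]
  constructor
  · rintro ⟨⟨h1, h2⟩, h3⟩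
    have h4 : 2 ≤ a := h3 a (Or.inr ⟨by omega, rfl⟩)
    have h5 : ∀ x ∈ u.1.take r, x = 1 := by
      intro x hx
      have := h2 _ ⟨x, hx, rfl⟩
      split_ifs at this <;> omega
    refine ⟨⟨⟨h1, h5⟩, fun x hx => ?_⟩, h4⟩
    have := h3 _ (Or.inl ⟨x, hx, rfl⟩)
    split_ifs at this <;> omega
  · rintro ⟨⟨⟨h1, h2⟩, h3⟩, h4⟩
    refine ⟨⟨h1, ?_⟩, ?_⟩
    · rintro x ⟨y, hy, rfl⟩
      rw [h2 y hy, if_neg (by omega)]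
    · rintro x (⟨y, hy, rfl⟩ | ⟨-, rfl⟩)
      · have := h3 y hy
        split_ifs <;> omega
      · exact h4

/-! ### The expansion of the nested bracket -/

theorem length_idListFrom (m : ℕ) (l : List ℕ) : (idListFrom m l).length = l.sum := by
  induction l generalizing m with
  | nil => rfl
  | cons r l ih => simp [idListFrom, ih]

theorem idListFrom_concat (m : ℕ) (l : List ℕ) (s : ℕ) :
    idListFrom m (l ++ [s]) = idListFrom m l ++ List.replicate s (m + l.length + 1) := by
  induction l generalizing m with
  | nil => simp [idListFrom]
  | cons r l ih =>
    simp only [List.cons_append, idListFrom, ih, List.append_assoc, List.length_cons]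
    congr 4
    omega

theorem isPacked_idListFrom {l : List ℕ} (hl : ∀ r ∈ l, 1 ≤ r) : IsPacked (idListFrom 0 l) := by
  refine ⟨fun a ha => ?_, fun a h1 ha => ?_⟩
  · rw [mem_idListFrom hl] at ha; omega
  · rw [mem_idListFrom hl] at ha ⊢; omega

theorem maxLetter_idListFrom {l : List ℕ} (hl : ∀ r ∈ l, 1 ≤ r) :
    maxLetter (idListFrom 0 l) = l.length := by
  have h : ∀ a, (1 ≤ a ∧ a ≤ maxLetter (idListFrom 0 l)) ↔ 0 + 1 ≤ a ∧ a ≤ 0 + l.length :=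
    fun a => by rw [← (isPacked_idListFrom hl).mem_iff, mem_idListFrom hl]
  have h1 := h (maxLetter (idListFrom 0 l))
  have h2 := h l.length
  omega

section

variable (K : Type*) [Field K]

open Classical in
-- Adding a last part `s` to the composition inserts a top block into `id(c)`. The upper set then
-- becomes a product on which the block condition splits into the same condition on `u` and `2 ≤ a`,
-- matching the terms of `appendTop_sub_appendBottom_M`.
theorem nestedBracket_eq_sum {r : ℕ} (hr : 1 ≤ r) (l : List ℕ) (hl : ∀ s ∈ l, 1 ≤ s)
    (w : PackedWord) (hw : w.1 = idListFrom 0 (r :: l)) :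
    nestedBracket K (r :: l) = ∑ u ∈ (upper w).filter (fun u => StartsWithBlock r u), M K u := by
  induction l using List.reverseRecOn generalizing w with
  | nil =>
    obtain rfl : w = idWord r := Subtype.ext (by simpa [idListFrom, idWord] using hw)
    have h : StartsWithBlock r (idWord r) := by
      rw [startsWithBlock_iff]
      simp [idWord]
    rw [upper_idWord, Finset.filter_singleton, if_pos h, Finset.sum_singleton, ← F_idWord]
    rfl
  | append_singleton l s ih =>
    have hs : 1 ≤ s := hl s (by simp)
    have hl' : ∀ t ∈ r :: l, 1 ≤ t := by
      intro t ht
      rcases List.mem_cons.1 ht with rfl | ht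
      · exact hr
      · exact hl t (by simp [ht])
    set v : PackedWord := ⟨idListFrom 0 (r :: l), isPacked_idListFrom hl'⟩ with hv
    have hmax : maxLetter v.1 = (r :: l).length := maxLetter_idListFrom hl'
    obtain rfl : w = insertLast s (maxLetter v.1 + 1) v := by
      refine Subtype.ext ?_
      rw [insertLast_val hs (by omega) le_rfl, blockAppend_top, hw, ← List.cons_append,
        idListFrom_concat, hmax, zero_add]
    have hlen : ∀ u ∈ upper v, r ≤ u.1.length := by
      intro u hu
      rw [(mem_upper.1 hu).length_eq, length_idListFrom, List.sum_cons]
      omega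
    have h1 : nestedBracket K (r :: (l ++ [s])) =
        bracket K (nestedBracket K (r :: l)) (F K (idWord s)) := by
      simp [nestedBracket]
    rw [h1, ih (fun t ht => hl t (by simp [ht])) v rfl, bracket_idWord K hs, map_sum,
      upper_insertLast_top hs, Finset.sum_filter, Finset.sum_filter,
      Finset.sum_image (insertLast_injOn hs v), Finset.sum_product]
    refine Finset.sum_congr rfl fun u hu => ?_
    have hmu := (mem_upper.1 hu).maxLetter_eq
    have h2 : ∀ a ∈ Finset.Icc 1 (maxLetter v.1 + 1),
        (if StartsWithBlock r (insertLast s a u) then M K (insertLast s a u) else 0) =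
          if 2 ≤ a then if StartsWithBlock r u then M K (insertLast s a u) else 0 else 0 := by
      intro a ha
      rw [Finset.mem_Icc] at ha
      rw [← ite_and, startsWithBlock_insertLast hs ha.1 (by omega) (hlen u hu)]
      simp only [and_comm]
    rw [Finset.sum_congr rfl h2, ← Finset.sum_filter]
    have h3 : (Finset.Icc 1 (maxLetter v.1 + 1)).filter (2 ≤ ·) =
        Finset.Icc 2 (maxLetter v.1 + 1) := by
      ext a
      simp only [Finset.mem_filter, Finset.mem_Icc]
      omega
    rw [h3]
    split_ifs
    · rw [appendTop_sub_appendBottom_M K hs, hmu]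
    · simp

end

/-! ### Primitivity -/

/-- Ranks depend only on the relative order of the letters. -/
theorem packList_map {w : List ℕ} {g : ℕ → ℕ} (hg : ∀ x ∈ w, ∀ y ∈ w, x < y → g x < g y) :
    packList (w.map g) = packList w := by
  have hle : ∀ x ∈ w, ∀ y ∈ w, (g x ≤ g y ↔ x ≤ y) := by
    intro x hx y hy
    refine ⟨fun h => not_lt.1 fun h' => (hg y hy x hx h').not_ge h, fun h => ?_⟩
    rcases h.eq_or_lt with rfl | h
    · exact le_rfl
    · exact (hg x hx y hy h).le
  rw [packList, packList, List.map_map]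
  refine List.map_congr_left fun a ha => ?_
  rw [Function.comp_apply]
  refine (Finset.card_bij (fun x _ => g x) ?_ ?_ ?_).symm
  · intro x hx
    rw [Finset.mem_filter, List.mem_toFinset] at hx ⊢
    exact ⟨List.mem_map_of_mem hx.1, (hle x hx.1 a ha).2 hx.2⟩
  · intro x hx y hy h
    rw [Finset.mem_filter, List.mem_toFinset] at hx hy
    exact le_antisymm ((hle x hx.1 y hy.1).1 h.le) ((hle y hy.1 x hx.1).1 h.ge)
  · intro y hy
    rw [Finset.mem_filter, List.mem_toFinset, List.mem_map] at hy
    obtain ⟨⟨x, hx, rfl⟩, h⟩ := hy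
    exact ⟨x, by rw [Finset.mem_filter, List.mem_toFinset]; exact ⟨hx, (hle x hx a ha).1 h⟩, rfl⟩

theorem IsPacked.packList_eq {w : List ℕ} (hw : IsPacked w) : packList w = w := by
  rw [packList]
  conv_rhs => rw [← List.map_id w]
  refine List.map_congr_left fun a ha => ?_
  have h : w.toFinset.filter (· ≤ a) = Finset.Icc 1 a := by
    ext x
    simp only [Finset.mem_filter, List.mem_toFinset, Finset.mem_Icc]
    exact ⟨fun h => ⟨hw.1 x h.1, h.2⟩, fun h => ⟨hw.mem_of_le ha h.1 h.2, h.2⟩⟩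
  simp [h]

theorem pack_val (u : PackedWord) : pack u.1 = u :=
  Subtype.ext u.2.packList_eq

theorem rank_lt {w : List ℕ} {x y : ℕ} (hy : y ∈ w) (hxy : x < y) :
    (w.toFinset.filter (· ≤ x)).card < (w.toFinset.filter (· ≤ y)).card := by
  refine Finset.card_lt_card ⟨fun a ha => ?_, fun h => ?_⟩
  · rw [Finset.mem_filter] at ha ⊢
    exact ⟨ha.1, ha.2.trans hxy.le⟩
  · have := h (Finset.mem_filter.2 ⟨List.mem_toFinset.2 hy, le_rfl⟩)
    rw [Finset.mem_filter] at this
    omega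

theorem pack_append_top {s m : ℕ} (hs : 1 ≤ s) {d : List ℕ} (hd : ∀ x ∈ d, x < m) :
    pack (d ++ List.replicate s m) = insertLast s (maxLetter (pack d).1 + 1) (pack d) := by
  refine Subtype.ext ?_
  have hp := isPacked_blockAppend (a := maxLetter (pack d).1 + 1) hs (pack d).2 (by omega) le_rfl
  rw [insertLast_val hs (by omega) le_rfl]
  -- Increasing on the letters of the word, `g` carries it to the packed target; packing does not
  -- see `g` and fixes the target.
  set g : ℕ → ℕ := fun x => if x < m then (d.toFinset.filter (· ≤ x)).card
    else maxLetter (pack d).1 + 1 with hg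
  have h : (d ++ List.replicate s m).map g =
      blockAppend s (maxLetter (pack d).1 + 1) (pack d).1 := by
    rw [blockAppend_top, List.map_append, List.map_replicate]
    congr 1
    · exact List.map_congr_left fun x hx => if_pos (hd x hx)
    · rw [hg]; simp
  rw [← hp.packList_eq, ← h, packList_map]
  · rfl
  · intro x hx y hy hxy
    rw [List.mem_append, List.mem_replicate] at hx hy
    rcases hy with hy | ⟨-, rfl⟩
    · have h1 := hd y hy
      simp only [hg, if_pos h1, if_pos (hxy.trans h1)]
      exact rank_lt hy hxy
    · rcases hx with hx | ⟨-, rfl⟩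
      · simp only [hg, if_pos hxy, lt_irrefl, if_false]
        exact Nat.lt_succ_of_le (le_maxLetter (List.mem_map.2 ⟨x, hx, rfl⟩))
      · omega

theorem pack_append_one {s : ℕ} (hs : 1 ≤ s) {d : List ℕ} (hd : ∀ x ∈ d, 1 ≤ x) :
    pack (d.map (· + 1) ++ List.replicate s 1) = insertLast s 1 (pack d) := by
  refine Subtype.ext ?_
  have hp := isPacked_blockAppend (a := 1) hs (pack d).2 le_rfl (by omega)
  rw [insertLast_val hs le_rfl (by omega)]
  set g : ℕ → ℕ := fun x => if 1 < x then (d.toFinset.filter (· ≤ x - 1)).card + 1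
    else 1 with hg
  have h : (d.map (· + 1) ++ List.replicate s 1).map g = blockAppend s 1 (pack d).1 := by
    rw [blockAppend_one (pack d).2, List.map_append, List.map_replicate, List.map_map]
    congr 1
    · change _ = List.map (· + 1) (packList d)
      rw [packList, List.map_map]
      refine List.map_congr_left fun x hx => ?_
      have := hd x hx
      simp only [Function.comp_apply, hg, if_pos (show 1 < x + 1 by omega), Nat.add_sub_cancel]
  rw [← hp.packList_eq, ← h, packList_map]
  · rfl
  · intro x hx y hy hxy
    have hx1 : 1 ≤ x := by
      rw [List.mem_append, List.mem_replicate, List.mem_map] at hx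
      rcases hx with ⟨z, -, rfl⟩ | ⟨-, rfl⟩ <;> omega
    rw [List.mem_append, List.mem_replicate, List.mem_map] at hy
    rcases hy with ⟨z, hz, rfl⟩ | ⟨-, rfl⟩
    · have h1 := hd z hz
      simp only [hg, if_pos (show 1 < z + 1 by omega), Nat.add_sub_cancel]
      split_ifs
      · exact Nat.succ_lt_succ (rank_lt hz (by omega))
      · exact Nat.succ_lt_succ (Finset.card_pos.2 ⟨z, by simp [hz]⟩)
    · omega

/-! ### The coproduct of a word with an appended block -/

section

variable (K : Type*) [Field K]

theorem comul_F (u : PackedWord) : comul K (F K u) =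
    ∑ p ∈ (Finset.range (u.1.length + 1)).filter (fun p => ∀ a ∈ u.1.take p, a ∉ u.1.drop p),
      F K (pack (u.1.take p)) ⊗ₜ[K] F K (pack (u.1.drop p)) := by
  simp [comul, F]

/-- Cuts up to the start of the block are admissible for `w` exactly when they are for `u`, cuts
strictly inside the block never are, and the final cut gives `w ⊗ 1`. The map `f` and the letter `a`
cover the top and bottom insertions at once; `E` is the effect on the right factor. -/
theorem comul_append {s a : ℕ} (hs : 1 ≤ s) {u w : PackedWord} {f : ℕ → ℕ}
    (hf : ∀ x ∈ u.1, ∀ y ∈ u.1, x < y → f x < f y) (hfa : ∀ x ∈ u.1, f x ≠ a)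
    (hw : w.1 = u.1.map f ++ List.replicate s a) (E : PackedWord → PackedWord)
    (hE : ∀ p, pack ((u.1.drop p).map f ++ List.replicate s a) = E (pack (u.1.drop p))) :
    comul K (F K w) = (∑ p ∈ (Finset.range (u.1.length + 1)).filter
        (fun p => ∀ a ∈ u.1.take p, a ∉ u.1.drop p),
      F K (pack (u.1.take p)) ⊗ₜ[K] F K (E (pack (u.1.drop p)))) +
        F K w ⊗ₜ[K] F K emptyWord := by
  have hlen : w.1.length = u.1.length + s := by simp [hw]
  have hinj : ∀ x ∈ u.1, ∀ y ∈ u.1, f x = f y → x = y := by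
    intro x hx y hy h
    rcases lt_trichotomy x y with h' | h' | h'
    · exact absurd h (hf x hx y hy h').ne
    · exact h'
    · exact absurd h (hf y hy x hx h').ne'
  have htake : ∀ p ≤ u.1.length, w.1.take p = (u.1.take p).map f := by
    intro p hp
    rw [hw, List.take_append_of_le_length (by simpa using hp), List.map_take]
  have hdrop : ∀ p ≤ u.1.length, w.1.drop p = (u.1.drop p).map f ++ List.replicate s a := by
    intro p hp
    rw [hw, List.drop_append_of_le_length (by simpa using hp), List.map_drop]
  have htot : w.1.take (u.1.length + s) = w.1 := by rw [← hlen, List.take_length]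
  have htot' : w.1.drop (u.1.length + s) = [] := by rw [← hlen, List.drop_length]
  have hset : (Finset.range (w.1.length + 1)).filter (fun p => ∀ a ∈ w.1.take p, a ∉ w.1.drop p) =
      insert (u.1.length + s) ((Finset.range (u.1.length + 1)).filter
        (fun p => ∀ a ∈ u.1.take p, a ∉ u.1.drop p)) := by
    ext p
    rw [Finset.mem_insert, Finset.mem_filter, Finset.mem_filter, Finset.mem_range,
      Finset.mem_range, hlen]
    rcases le_or_gt p u.1.length with hp | hp
    · have h1 : (∀ b ∈ w.1.take p, b ∉ w.1.drop p) ↔ ∀ b ∈ u.1.take p, b ∉ u.1.drop p := by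
        rw [htake p hp, hdrop p hp]
        constructor
        · intro h b hb hb'
          exact h _ (List.mem_map_of_mem hb) (List.mem_append_left _ (List.mem_map_of_mem hb'))
        · intro h b hb hb'
          obtain ⟨x, hx, rfl⟩ := List.mem_map.1 hb
          rcases List.mem_append.1 hb' with hb' | hb'
          · obtain ⟨y, hy, hxy⟩ := List.mem_map.1 hb'
            obtain rfl := hinj y (List.mem_of_mem_drop hy) x (List.mem_of_mem_take hx) hxy
            exact h y hx hy
          · exact hfa x (List.mem_of_mem_take hx) (List.mem_replicate.1 hb').2
      rw [h1]
      constructor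
      · rintro ⟨-, h⟩
        exact Or.inr ⟨by omega, h⟩
      · rintro (h | ⟨-, h⟩)
        · omega
        · exact ⟨by omega, h⟩
    · constructor
      · rintro ⟨h, h'⟩
        -- A cut strictly inside the block would leave the letter `a` on both sides.
        refine Or.inl (by_contra fun hne => ?_)
        refine h' a ?_ ?_
        · rw [hw, List.take_append, List.mem_append, List.take_replicate, List.mem_replicate]
          exact Or.inr ⟨by simp only [List.length_map]; omega, rfl⟩
        · rw [hw, List.drop_append, List.mem_append, List.drop_replicate, List.mem_replicate]
          exact Or.inr ⟨by simp only [List.length_map]; omega, rfl⟩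
      · rintro (rfl | ⟨h, -⟩)
        · exact ⟨by omega, by simp [htot']⟩
        · omega
  have hnot : u.1.length + s ∉ (Finset.range (u.1.length + 1)).filter
      (fun p => ∀ a ∈ u.1.take p, a ∉ u.1.drop p) := by
    rw [Finset.mem_filter, Finset.mem_range]
    omega
  rw [comul_F, hset, Finset.sum_insert hnot, htot, htot', pack_val, add_comm]
  congr 1
  refine Finset.sum_congr rfl fun p hp => ?_
  rw [Finset.mem_filter, Finset.mem_range] at hp
  rw [htake p (by omega), hdrop p (by omega), hE]
  congr 2
  exact Subtype.ext (packList_map fun x hx y hy =>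
    hf x (List.mem_of_mem_take hx) y (List.mem_of_mem_take hy))

theorem comul_appendTop_F {s : ℕ} (hs : 1 ≤ s) (u : PackedWord) :
    comul K (appendTop K s (F K u)) =
      TensorProduct.map LinearMap.id (appendTop K s) (comul K (F K u)) +
        appendTop K s (F K u) ⊗ₜ[K] F K emptyWord := by
  rw [appendTop_F, comul_append K hs (u := u) (f := id) (a := maxLetter u.1 + 1)
    (fun x _ y _ h => h) (fun x hx => (Nat.lt_succ_of_le (le_maxLetter hx)).ne)
    (by rw [insertLast_val hs (by omega) le_rfl, blockAppend_top, List.map_id])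
    (fun v => insertLast s (maxLetter v.1 + 1) v)
    (fun p => by
      rw [List.map_id]
      exact pack_append_top hs fun x hx =>
        Nat.lt_succ_of_le (le_maxLetter (List.mem_of_mem_drop hx))), comul_F, map_sum]
  simp only [TensorProduct.map_tmul, LinearMap.id_apply, appendTop_F]

theorem comul_appendBottom_F {s : ℕ} (hs : 1 ≤ s) (u : PackedWord) :
    comul K (appendBottom K s (F K u)) =
      TensorProduct.map LinearMap.id (appendBottom K s) (comul K (F K u)) +
        appendBottom K s (F K u) ⊗ₜ[K] F K emptyWord := by
  rw [appendBottom_F, comul_append K hs (u := u) (f := (· + 1)) (a := 1)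
    (fun x _ y _ h => Nat.succ_lt_succ h) (fun x hx => by have := u.2.1 x hx; omega)
    (by rw [insertLast_val hs le_rfl (by omega), blockAppend_one u.2])
    (insertLast s 1)
    (fun p => pack_append_one hs fun x hx => u.2.1 x (List.mem_of_mem_drop hx)), comul_F, map_sum]
  simp only [TensorProduct.map_tmul, LinearMap.id_apply, appendBottom_F]

theorem comul_appendTop_sub_appendBottom {s : ℕ} (hs : 1 ≤ s) (x : WQSym K) :
    comul K ((appendTop K s - appendBottom K s) x) =
      TensorProduct.map LinearMap.id (appendTop K s - appendBottom K s) (comul K x) +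
        (appendTop K s - appendBottom K s) x ⊗ₜ[K] F K emptyWord := by
  induction x using Finsupp.induction_linear with
  | zero => simp
  | add x y hx hy =>
    rw [map_add, map_add, hx, hy, map_add, map_add, TensorProduct.add_tmul]
    abel
  | single u r =>
    rw [← mul_one r, ← smul_eq_mul, ← Finsupp.smul_single, map_smul, map_smul, map_smul, map_smul,
      ← TensorProduct.smul_tmul', ← smul_add]
    congr 1
    change comul K ((appendTop K s - appendBottom K s) (F K u)) =
      TensorProduct.map LinearMap.id (appendTop K s - appendBottom K s) (comul K (F K u)) +
        (appendTop K s - appendBottom K s) (F K u) ⊗ₜ[K] F K emptyWord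
    rw [LinearMap.sub_apply, map_sub, comul_appendTop_F K hs, comul_appendBottom_F K hs,
      ← LinearMap.lTensor_def, ← LinearMap.lTensor_def, ← LinearMap.lTensor_def,
      LinearMap.lTensor_sub, TensorProduct.sub_tmul]
    change _ = LinearMap.lTensor _ (appendTop K s) (comul K (F K u)) -
      LinearMap.lTensor _ (appendBottom K s) (comul K (F K u)) + _
    abel

/-- With `D` the difference of the two operators and `x` primitive, `(id ⊗ D) Δ(x) = x ⊗ D(1) + 1 ⊗
D x`, and `D(1) = 0`. -/
theorem isZie_bracket_idWord {s : ℕ} (hs : 1 ≤ s) {x : WQSym K} (hx : IsZie K x) :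
    IsZie K (bracket K x (F K (idWord s))) := by
  rw [IsZie, bracket_idWord K hs, comul_appendTop_sub_appendBottom K hs, hx, map_add,
    TensorProduct.map_tmul, TensorProduct.map_tmul, appendTop_sub_appendBottom_emptyWord,
    TensorProduct.tmul_zero, zero_add, LinearMap.id_apply, add_comm]

/-- The word `id_r` is a block appended to the empty word, so only the two extreme cuts survive. -/
theorem isZie_idWord {r : ℕ} (hr : 1 ≤ r) : IsZie K (F K (idWord r)) := by
  have h := comul_append K hr (u := emptyWord) (w := idWord r) (f := id) (a := 1)
    (fun x _ y _ h => h) (by simp [emptyWord]) (by simp [emptyWord, idWord])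
    (fun _ => idWord r) (fun p => by
      have h1 : (emptyWord.1.drop p).map id ++ List.replicate r 1 = (idWord r).1 := by
        simp [emptyWord, idWord]
      rw [h1, pack_val])
  have h2 : (Finset.range (emptyWord.1.length + 1)).filter
      (fun p => ∀ a ∈ emptyWord.1.take p, a ∉ emptyWord.1.drop p) = {0} := by
    simp [emptyWord]
  rw [h2, Finset.sum_singleton, List.take_zero] at h
  rw [IsZie, h, add_comm]
  rfl

theorem isZie_nestedBracket {r : ℕ} (hr : 1 ≤ r) (l : List ℕ) (hl : ∀ s ∈ l, 1 ≤ s) :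
    IsZie K (nestedBracket K (r :: l)) := by
  induction l using List.reverseRecOn with
  | nil => exact isZie_idWord K hr
  | append_singleton l s ih =>
    have h : nestedBracket K (r :: (l ++ [s])) =
        bracket K (nestedBracket K (r :: l)) (F K (idWord s)) := by
      simp [nestedBracket]
    rw [h]
    exact isZie_bracket_idWord K (hl s (by simp)) (ih fun t ht => hl t (by simp [ht]))

end

end PAsRight

/-! ### The main theorem -/

open PAsRight
open Classical in
theorem mainTheorem8 (K : Type*) [Field K] [CharZero K] (k : ℕ) (hk : 1 ≤ k)
    (c : Composition k) :
    theta K c =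
        ∑ u ∈ (upper (idComp c)).filter (fun u => StartsWithBlock (c.blocks.headD 0) u), M K u ∧
      IsZie K (theta K c) := by
  -- As `k ≥ 1`, there is a first part, so the default values for the empty list play no role.
  obtain ⟨r, l, hc⟩ : ∃ r l, c.blocks = r :: l := by
    refine List.exists_cons_of_ne_nil fun h => ?_
    have := c.blocks_sum
    rw [h, List.sum_nil] at this
    omega
  have hr : 1 ≤ r := c.one_le_blocks (by simp [hc])
  have hl : ∀ s ∈ l, 1 ≤ s := fun s hs => c.one_le_blocks (by simp [hc, hs])
  rw [theta, hc]
  exact ⟨nestedBracket_eq_sum K hr l hl (idComp c) (by rw [← hc]; rfl),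
    isZie_nestedBracket K hr l hl⟩
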